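/- Let $d\ge 3$ and let $\{S_m\}_{m\ge 0}$ be a simple random walk on $\mathbb{Z}^d$ with $S_0=0$, under a probability measure $P$. For $D\subset\mathbb{Z}^d$ put $T_D:=\inf\{m\ge 1: S_m\in D\}$ (with $\inf\emptyset=\infty$) and $T_x:=T_{\{x\}}$. Fix $M\in\mathbb{N}$ and let $$\mathcal{H}:=\{H\subset\mathbb{Z}^d:\ 0\notin H,\ |H|\le M,\ P(T_x<T_H)>0 \text{ for all } x\in H^c\}.$$ For $H,G\subset\mathbb{Z}^d$ let $\partial_H G:=\{y\in G:\ y+H\subset G^c\}$, and let $R(n):=\{S_0,S_1,\dots,S_n\}$. Then for every $H\in\mathcal{H}$, $$\lim_{n\to\infty}\frac{|\partial_H R(n)|}{n}=q\qquad\text{almost surely},$$ where $$q:=P\Big(\big(\{S'_m\}_{m=0}^\infty\cup\{S_m\}_{m=0}^\infty\big)\cap H=\emptyset\ \text{ and }\ 0\notin\{S_m\}_{m=1}^\infty\Big)$$ and $\{S'_m\}_{m=0}^\infty$ is an independent copy of $\{-S_m\}_{m=0}^\infty$. -/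

import Mathlib

open MeasureTheory ProbabilityTheory Filter Topology

namespace RangeBoundary

/-- `S` is a simple random walk on `ℤ^d` started at the origin: `S 0 = 0` almost surely, the
increments are independent, and each increment takes each of the `2 d` values `± e_i` with
probability `1 / (2 d)`. -/
structure IsSimpleRandomWalk {Ω : Type*} [MeasurableSpace Ω] (P : Measure Ω) {d : ℕ}
    (S : ℕ → Ω → (Fin d → ℤ)) : Prop where
  measurable : ∀ n, Measurable (S n)
  start : ∀ᵐ ω ∂P, S 0 ω = 0
  indep : iIndepFun (fun n ω => S (n + 1) ω - S n ω) P
  step_pos : ∀ (n : ℕ) (i : Fin d),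
    P {ω | S (n + 1) ω - S n ω = Pi.single i 1} = (2 * (d : ENNReal))⁻¹
  step_neg : ∀ (n : ℕ) (i : Fin d),
    P {ω | S (n + 1) ω - S n ω = -Pi.single i 1} = (2 * (d : ENNReal))⁻¹

/-- The range `R(n) = {s 0, s 1, …, s n}` of the path `s` up to time `n`. -/
def pathRange {d : ℕ} (s : ℕ → (Fin d → ℤ)) (n : ℕ) : Set (Fin d → ℤ) :=
  s '' Set.Iic n

/-- The generalized boundary `∂_H G = {y ∈ G : y + H ⊆ Gᶜ}`. -/
def boundary {d : ℕ} (H G : Set (Fin d → ℤ)) : Set (Fin d → ℤ) :=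
  {y | y ∈ G ∧ ∀ h ∈ H, y + h ∈ Gᶜ}

/-- The hitting time `T_D = inf {m ≥ 1 : s m ∈ D}` of the path `s`, with `inf ∅ = ∞`. -/
noncomputable def hitTime {d : ℕ} (s : ℕ → (Fin d → ℤ)) (D : Set (Fin d → ℤ)) : ℕ∞ :=
  sInf {t : ℕ∞ | ∃ m : ℕ, 1 ≤ m ∧ s m ∈ D ∧ t = (m : ℕ∞)}

/-- The class `𝓗(M)` of sets `H ⊆ ℤ^d` with `0 ∉ H`, `|H| ≤ M` and `P(T_x < T_H) > 0` for every
`x ∉ H`. -/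
def admissible {Ω : Type*} [MeasurableSpace Ω] (P : Measure Ω) {d : ℕ}
    (S : ℕ → Ω → (Fin d → ℤ)) (M : ℕ) : Set (Set (Fin d → ℤ)) :=
  {H | 0 ∉ H ∧ H.encard ≤ (M : ℕ∞) ∧
    ∀ x ∈ Hᶜ, 0 < P {ω | hitTime (fun m => S m ω) {x} < hitTime (fun m => S m ω) H}}

/-- The probability that `({S'_m : m ≥ 0} ∪ {S_m : m ≥ 0}) ∩ H = ∅` and `0 ∉ {S_m : m ≥ 1}`, where
`S'` is an independent copy of `-S`. The two independent processes are realized on the product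
space: `S` is read off the first coordinate, `S'` is `-S` read off the second one. -/
noncomputable def limitConst {Ω : Type*} [MeasurableSpace Ω] (P : Measure Ω) {d : ℕ}
    (S : ℕ → Ω → (Fin d → ℤ)) (H : Set (Fin d → ℤ)) : ℝ :=
  (P.prod P).real {p : Ω × Ω |
    (Set.range (fun m => -S m p.2) ∪ Set.range (fun m => S m p.1)) ∩ H = ∅ ∧
      0 ∉ (fun m => S m p.1) '' Set.Ici 1}

end RangeBoundary

/-!
The points of `∂_H R(n)` are counted by their last visit: `S_k` with `k ≤ n` contributes exactly
when the walk does not return to `S_k` during `(k, n]` and avoids `S_k + H` during `[0, n]`.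
Extending the walk to a two-sided walk with i.i.d. steps, let `A` be the event that the two-sided
walk avoids `H` at all times and the origin at all positive times, and let `A L` be its truncation
to times in `[-L, L]`. With `T` the shift of the steps, last-visit counting gives

`∑_{k < n} 1_A ∘ T^k ≤ |∂_H R(n)| ≤ ∑_{k < n} 1_{A L} ∘ T^k + 2 L + 1`

(`birkhoffSum_boundaryEvent_le_ncard`, `ncard_boundary_le_birkhoffSum`), and the probability of `A`
is the constant `q` (`IsSimpleRandomWalk.limitConst_eq`).

The event `A L` depends on `2 L` steps only, so the averages of `1_{A L} ∘ T^k` converge almost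
surely to the probability of `A L` by the strong law of large numbers along residue classes
(`ae_tendsto_birkhoffSum_of_cylinderEvents`). Since `A L` decreases to `A`, this settles the upper
bound. For the lower bound one needs the averages of `1_A ∘ T^k`; they are compared with those of
`1_{A L} ∘ T^k` by means of the maximal ergodic inequality
(`mul_measureReal_exists_birkhoffSum_gt_le`), which bounds the probability that the set `A L \ A`
is ever visited with a large frequency (`ae_tendsto_birkhoffSum_iInter`).

The argument works for i.i.d. steps of any law (`ae_tendsto_ncard_boundary_infinitePi`). The
two-sided walk is realized on `Ω × Ω`, with the future read off the first and the past off the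
second coordinate.
-/

namespace RangeBoundary

/-! ### A pointwise ergodic theorem for limits of sets -/

section Ergodic

variable {X : Type*}

/-- The maximal Birkhoff sum `max_{0 ≤ n ≤ N} ∑_{k < n} g (T^k x)`, given by the recursion
`M_{N+1} = max 0 (g + M_N ∘ T)`. -/
def maxBirkhoffSum (T : X → X) (g : X → ℝ) : ℕ → X → ℝ
  | 0 => fun _ => 0
  | N + 1 => fun x => max 0 (g x + maxBirkhoffSum T g N (T x))

lemma maxBirkhoffSum_nonneg (T : X → X) (g : X → ℝ) (N : ℕ) (x : X) :
    0 ≤ maxBirkhoffSum T g N x := by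
  cases N with
  | zero => exact le_rfl
  | succ N => exact le_max_left _ _

lemma maxBirkhoffSum_le_succ (T : X → X) (g : X → ℝ) (N : ℕ) (x : X) :
    maxBirkhoffSum T g N x ≤ maxBirkhoffSum T g (N + 1) x := by
  induction N generalizing x with
  | zero => exact maxBirkhoffSum_nonneg T g 1 x
  | succ N ih => exact max_le_max le_rfl (by linarith [ih (T x)])

lemma birkhoffSum_le_maxBirkhoffSum (T : X → X) (g : X → ℝ) {n N : ℕ} (hn : n ≤ N) (x : X) :
    birkhoffSum T g n x ≤ maxBirkhoffSum T g N x := by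
  induction N generalizing n x with
  | zero =>
    obtain rfl : n = 0 := by omega
    simp [maxBirkhoffSum]
  | succ N ih =>
    cases n with
    | zero => simpa using maxBirkhoffSum_nonneg T g (N + 1) x
    | succ n =>
      rw [birkhoffSum_succ']
      exact le_max_of_le_right (by linarith [ih (n := n) (by omega) (T x)])

variable [MeasurableSpace X] {μ : Measure X} {T : X → X}

lemma measurable_maxBirkhoffSum (hT : Measurable T) {g : X → ℝ} (hg : Measurable g) (N : ℕ) :
    Measurable (maxBirkhoffSum T g N) := by
  induction N with
  | zero => exact measurable_const
  | succ N ih => exact measurable_const.max (hg.add (ih.comp hT))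

lemma integrable_maxBirkhoffSum (hT : MeasurePreserving T μ μ) {g : X → ℝ} (hg : Integrable g μ)
    (N : ℕ) : Integrable (maxBirkhoffSum T g N) μ := by
  induction N with
  | zero => exact integrable_zero _ _ _
  | succ N ih =>
    exact (integrable_zero X ℝ μ).sup (hg.add (hT.integrable_comp_of_integrable ih))

/-- The maximal ergodic inequality: on the set where `M = maxBirkhoffSum T g (N + 1)` is positive
one has `M ≤ g + M ∘ T`, and `M` and `M ∘ T` have the same integral. -/
lemma setIntegral_maxBirkhoffSum_pos_nonneg (hT : MeasurePreserving T μ μ) {g : X → ℝ}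
    (hgm : Measurable g) (hg : Integrable g μ) (N : ℕ) :
    0 ≤ ∫ x in {x | 0 < maxBirkhoffSum T g N x}, g x ∂μ := by
  cases N with
  | zero => simp [maxBirkhoffSum]
  | succ N =>
    set M := maxBirkhoffSum T g (N + 1) with hM
    have hMm : Measurable M := measurable_maxBirkhoffSum hT.measurable hgm _
    have hMi : Integrable M μ := integrable_maxBirkhoffSum hT hg _
    have hA : MeasurableSet {x | 0 < M x} := measurableSet_lt measurable_const hMm
    have hMT : ∫ x, M (T x) ∂μ = ∫ x, M x ∂μ := by
      have h := integral_map (μ := μ) hT.measurable.aemeasurable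
        (f := M) hMm.aestronglyMeasurable
      rw [hT.map_eq] at h
      exact h.symm
    have hMTi : Integrable (fun x => M (T x)) μ := hT.integrable_comp_of_integrable hMi
    have key : ∫ x, M x ∂μ ≤ ∫ x, ({x | 0 < M x}.indicator g x + M (T x)) ∂μ := by
      refine integral_mono hMi ((hg.indicator hA).add hMTi) fun x => ?_
      by_cases hx : 0 < M x
      · have h1 : M x = max 0 (g x + maxBirkhoffSum T g N (T x)) := rfl
        have h2 := maxBirkhoffSum_le_succ T g N (T x)
        have h3 : M x = g x + maxBirkhoffSum T g N (T x) := by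
          rcases max_choice (0 : ℝ) (g x + maxBirkhoffSum T g N (T x)) with h | h
          · rw [h1, h] at hx; exact absurd hx (lt_irrefl _)
          · rw [h1, h]
        simp only [Set.indicator_of_mem (show x ∈ {x | 0 < M x} from hx)]
        linarith
      · have := maxBirkhoffSum_nonneg T g (N + 1) (T x)
        simp only [Set.indicator_of_notMem (show x ∉ {x | 0 < M x} from hx)]
        linarith
    rw [integral_add (hg.indicator hA) hMTi, integral_indicator hA, hMT] at key
    linarith

/-- The weak-type form of the maximal ergodic inequality, for visits to a set `B`. -/
lemma mul_measureReal_exists_birkhoffSum_gt_le [IsProbabilityMeasure μ]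
    (hT : MeasurePreserving T μ μ) {B : Set X} (hB : MeasurableSet B) {ε : ℝ} (hε : 0 < ε) :
    ε * μ.real {x | ∃ n : ℕ, ε * n < birkhoffSum T (B.indicator fun _ => (1 : ℝ)) n x} ≤
      μ.real B := by
  set f : X → ℝ := B.indicator fun _ => (1 : ℝ) with hf
  have hfm : Measurable f := measurable_const.indicator hB
  have hfi : Integrable f μ := (integrable_const (1 : ℝ)).indicator hB
  have hf0 : ∀ x, 0 ≤ f x := fun x => Set.indicator_nonneg (fun _ _ => zero_le_one) x
  have hfint : ∫ x, f x ∂μ = μ.real B := by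
    rw [hf, integral_indicator hB]; simp
  set g : X → ℝ := fun x => f x - ε with hg
  have hgm : Measurable g := hfm.sub_const ε
  have hgi : Integrable g μ := hfi.sub (integrable_const ε)
  let A : ℕ → Set X := fun N => {x | 0 < maxBirkhoffSum T g N x}
  have hA : ∀ N, ε * μ.real (A N) ≤ μ.real B := fun N => by
    have h := setIntegral_maxBirkhoffSum_pos_nonneg hT hgm hgi N
    have h1 : ∫ x in A N, g x ∂μ = ∫ x in A N, f x ∂μ - μ.real (A N) * ε := by
      rw [hg, integral_sub hfi.integrableOn (integrable_const ε).integrableOn]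
      simp
    have h2 : ∫ x in A N, f x ∂μ ≤ ∫ x, f x ∂μ :=
      setIntegral_le_integral hfi (Eventually.of_forall hf0)
    change 0 ≤ ∫ x in A N, g x ∂μ at h
    rw [hfint] at h2
    linarith
  have hmono : Monotone A := monotone_nat_of_le_succ fun N x hx =>
    lt_of_lt_of_le hx (maxBirkhoffSum_le_succ T g N x)
  have hlim : Tendsto (fun N => ε * μ.real (A N)) atTop (𝓝 (ε * μ.real (⋃ N, A N))) := by
    refine Tendsto.const_mul _ ?_
    exact (ENNReal.tendsto_toReal (measure_ne_top _ _)).comp (tendsto_measure_iUnion_atTop hmono)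
  refine le_trans (mul_le_mul_of_nonneg_left (measureReal_mono ?_) hε.le)
    (le_of_tendsto' hlim hA)
  rintro x ⟨n, hn⟩
  refine Set.mem_iUnion.2 ⟨n, lt_of_lt_of_le ?_ (birkhoffSum_le_maxBirkhoffSum T g le_rfl x)⟩
  have : birkhoffSum T g n x = birkhoffSum T f n x - ε * n := by
    simp [birkhoffSum, hg, Finset.sum_sub_distrib, mul_comm]
  linarith

/-- If the pointwise ergodic theorem (with constant limit) holds for the sets of a decreasing
sequence, then it holds for their intersection. By the maximal inequality the frequency of visits
to `A L \ ⋂ L, A L` is small uniformly in time, outside an event of small probability. -/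
lemma ae_tendsto_birkhoffSum_iInter [IsProbabilityMeasure μ] (hT : MeasurePreserving T μ μ)
    {A : ℕ → Set X} (hA : ∀ L, MeasurableSet (A L)) (hanti : Antitone A)
    (hlim : ∀ L, ∀ᵐ x ∂μ, Tendsto
      (fun n : ℕ => birkhoffSum T ((A L).indicator fun _ => (1 : ℝ)) n x / n) atTop
      (𝓝 (μ.real (A L)))) :
    ∀ᵐ x ∂μ, Tendsto
      (fun n : ℕ => birkhoffSum T ((⋂ L, A L).indicator fun _ => (1 : ℝ)) n x / n) atTop
      (𝓝 (μ.real (⋂ L, A L))) := by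
  set I : Set X := ⋂ L, A L with hI
  have hIm : MeasurableSet I := MeasurableSet.iInter hA
  have hIA : ∀ L, I ⊆ A L := fun L => Set.iInter_subset _ _
  have hμ : Tendsto (fun L => μ.real (A L)) atTop (𝓝 (μ.real I)) :=
    (ENNReal.tendsto_toReal (measure_ne_top _ _)).comp
      (tendsto_measure_iInter_atTop (fun L => (hA L).nullMeasurableSet) hanti
        ⟨0, measure_ne_top _ _⟩)
  have hdiff : Tendsto (fun L => μ.real (A L \ I)) atTop (𝓝 0) := by
    have h : ∀ L, μ.real (A L \ I) = μ.real (A L) - μ.real I := fun L =>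
      measureReal_sdiff (hIA L) hIm
    simp_rw [h]
    simpa using hμ.sub_const (μ.real I)
  have hsmall : ∀ m : ℕ, ∀ᵐ x ∂μ, ∃ L, ∀ n : ℕ,
      birkhoffSum T ((A L \ I).indicator fun _ => (1 : ℝ)) n x ≤ 1 / ((m : ℝ) + 1) * n := by
    intro m
    have hε : (0 : ℝ) < 1 / ((m : ℝ) + 1) := by positivity
    set ε : ℝ := 1 / ((m : ℝ) + 1)
    rw [ae_iff]
    set Z := {x | ¬ ∃ L, ∀ n : ℕ,
      birkhoffSum T ((A L \ I).indicator fun _ => (1 : ℝ)) n x ≤ ε * n} with hZ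
    have hZle : ∀ L, ε * μ.real Z ≤ μ.real (A L \ I) := fun L => by
      refine le_trans (mul_le_mul_of_nonneg_left (measureReal_mono fun x hx => ?_) hε.le)
        (mul_measureReal_exists_birkhoffSum_gt_le hT ((hA L).diff hIm) hε)
      simp only [hZ, not_exists, not_forall, not_le, Set.mem_ofPred_eq] at hx
      exact hx L
    have h0 : ε * μ.real Z ≤ 0 := ge_of_tendsto' hdiff hZle
    have h1 : μ.real Z = 0 :=
      le_antisymm (nonpos_of_mul_nonpos_right h0 hε) measureReal_nonneg
    simpa [measureReal_eq_zero_iff] using h1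
  filter_upwards [ae_all_iff.2 hlim, ae_all_iff.2 hsmall] with x hx hs
  rw [tendsto_order]
  constructor
  · intro a ha
    obtain ⟨m, hm⟩ := exists_nat_one_div_lt (sub_pos.2 ha)
    obtain ⟨L, hL⟩ := hs m
    have hlt : a + 1 / ((m : ℝ) + 1) < μ.real (A L) := by
      linarith [measureReal_mono (μ := μ) (hIA L)]
    filter_upwards [(tendsto_order.1 (hx L)).1 _ hlt, eventually_gt_atTop 0] with n hn hn0
    have hn0' : (0 : ℝ) < n := Nat.cast_pos.2 hn0
    have hsum : birkhoffSum T ((A L).indicator fun _ => (1 : ℝ)) n x =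
        birkhoffSum T (I.indicator fun _ => (1 : ℝ)) n x +
          birkhoffSum T ((A L \ I).indicator fun _ => (1 : ℝ)) n x := by
      simp only [birkhoffSum, ← Finset.sum_add_distrib]
      refine Finset.sum_congr rfl fun k _ => ?_
      by_cases h1 : T^[k] x ∈ I
      · simp [h1, hIA L h1]
      · by_cases h2 : T^[k] x ∈ A L <;> simp [h1, h2]
    rw [lt_div_iff₀ hn0'] at hn ⊢
    have := hL n
    rw [hsum] at hn
    linarith
  · intro b hb
    obtain ⟨L, hL⟩ := ((tendsto_order.1 hμ).2 b hb).exists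
    filter_upwards [(tendsto_order.1 (hx L)).2 b hL] with n hn
    refine lt_of_le_of_lt (div_le_div_of_nonneg_right ?_ (Nat.cast_nonneg n)) hn
    exact Finset.sum_le_sum fun k _ =>
      Set.indicator_le_indicator_of_subset (hIA L) (fun _ => zero_le_one) _

end Ergodic

/-! ### The shift on two-sided i.i.d. sequences -/

/-- If the averages along every residue class modulo `b` tend to `c`, so do the full averages. -/
lemma tendsto_sum_range_div_of_residues {g : ℕ → ℝ} (hg : ∀ k, 0 ≤ g k) {b : ℕ} (hb : 0 < b)
    {c : ℝ} (h : ∀ r < b, Tendsto (fun m : ℕ => (∑ j ∈ Finset.range m, g (r + b * j)) / m) atTop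
      (𝓝 c)) :
    Tendsto (fun n : ℕ => (∑ k ∈ Finset.range n, g k) / n) atTop (𝓝 c) := by
  have hb' : (0 : ℝ) < b := Nat.cast_pos.2 hb
  have hsplit : ∀ m : ℕ, ∑ k ∈ Finset.range (b * m), g k =
      ∑ r ∈ Finset.range b, ∑ j ∈ Finset.range m, g (r + b * j) := by
    intro m
    induction m with
    | zero => simp
    | succ m ih =>
      rw [Nat.mul_succ, Finset.sum_range_add, ih, ← Finset.sum_add_distrib]
      refine Finset.sum_congr rfl fun r _ => ?_
      rw [Finset.sum_range_succ, add_comm (b * m) r]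
  refine tendsto_div_of_monotone_of_exists_subseq_tendsto_div _ c
    (fun m n hmn => Finset.sum_le_sum_of_subset_of_nonneg (Finset.range_mono hmn)
      fun k _ _ => hg k) fun a ha => ⟨fun m => b * m, ?_, ?_, ?_⟩
  · obtain ⟨N, hN⟩ := exists_nat_gt (1 / (a - 1))
    filter_upwards [eventually_ge_atTop N] with m hm
    have h1 : 1 / (a - 1) < m := lt_of_lt_of_le hN (Nat.cast_le.2 hm)
    rw [div_lt_iff₀ (sub_pos.2 ha)] at h1
    push_cast
    nlinarith
  · exact tendsto_id.const_mul_atTop' hb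
  · have hsum : Tendsto (fun m : ℕ => (∑ r ∈ Finset.range b,
        (∑ j ∈ Finset.range m, g (r + b * j)) / m) / b) atTop
        (𝓝 ((∑ _r ∈ Finset.range b, c) / b)) :=
      (tendsto_finsetSum _ fun r hr => h r (Finset.mem_range.1 hr)).div_const _
    have hc : (∑ _r ∈ Finset.range b, c) / b = c := by
      simp [hb'.ne']
    rw [hc] at hsum
    refine hsum.congr fun m => ?_
    rw [hsplit, ← Finset.sum_div, div_div, Nat.cast_mul, mul_comm (b : ℝ)]

section Shift

variable {E : Type*}

/-- The left shift on two-sided sequences. -/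
def shift (w : ℤ → E) : ℤ → E := fun i => w (i + 1)

lemma shift_iterate (k : ℕ) (w : ℤ → E) : shift^[k] w = fun i => w (i + k) := by
  induction k generalizing w with
  | zero => simp
  | succ k ih =>
    rw [Function.iterate_succ_apply, ih]
    funext i
    simp only [shift]
    congr 1
    push_cast
    ring

variable [MeasurableSpace E]

lemma measurePreserving_shift (μ : Measure E) [IsProbabilityMeasure μ] :
    MeasurePreserving shift (Measure.infinitePi fun _ : ℤ => μ)
      (Measure.infinitePi fun _ : ℤ => μ) where
  measurable := measurable_pi_lambda _ fun i => measurable_pi_apply (i + 1)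
  map_eq := Measure.map_infinitePi_infinitePi_of_inj (P := fun _ : ℤ => μ)
    (f := fun i : ℤ => i + 1) (add_left_injective 1)

lemma measurable_shift_iterate_cylinderEvents {I J : Set ℤ} {k : ℕ}
    (h : ∀ i ∈ I, i + (k : ℤ) ∈ J) :
    @Measurable _ _ (cylinderEvents J) (cylinderEvents I) (shift^[k] : (ℤ → E) → ℤ → E) := by
  refine (@measurable_cylinderEvents_iff _ _ _ (cylinderEvents J) _ _ _).2 fun i hi => ?_
  simp only [shift_iterate]
  exact measurable_cylinderEvent_apply (h i hi)

lemma indep_cylinderEvents (μ : Measure E) [IsProbabilityMeasure μ] {I J : Set ℤ}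
    (hIJ : Disjoint I J) :
    Indep (cylinderEvents (X := fun _ : ℤ => E) I) (cylinderEvents J)
      (Measure.infinitePi fun _ : ℤ => μ) := by
  have h := iIndepFun_infinitePi (P := fun _ : ℤ => μ) (X := fun _ x => x)
    fun _ => measurable_id
  rw [iIndepFun_iff_iIndep] at h
  exact indep_iSup_of_disjoint (fun i => (measurable_pi_apply i).comap_le) h hIJ

/-- The strong law of large numbers for a local event of a two-sided i.i.d. sequence: times in a
fixed residue class modulo `2 L + 1` see disjoint windows of coordinates. -/
lemma ae_tendsto_birkhoffSum_of_cylinderEvents (μ : Measure E) [IsProbabilityMeasure μ] {L : ℕ}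
    {A : Set (ℤ → E)} (hA : MeasurableSet[cylinderEvents (Set.Ico (-L : ℤ) L)] A) :
    ∀ᵐ w ∂(Measure.infinitePi fun _ : ℤ => μ), Tendsto
      (fun n : ℕ => birkhoffSum shift (A.indicator fun _ => (1 : ℝ)) n w / n) atTop
      (𝓝 ((Measure.infinitePi fun _ : ℤ => μ).real A)) := by
  set Q : Measure (ℤ → E) := Measure.infinitePi fun _ : ℤ => μ with hQ
  set f : (ℤ → E) → ℝ := A.indicator fun _ => (1 : ℝ) with hf
  have hT : MeasurePreserving shift Q Q := measurePreserving_shift μ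
  have hA' : MeasurableSet A := cylinderEvents_le_pi _ hA
  have hfm : Measurable f := measurable_const.indicator hA'
  have hfc : @Measurable _ _ (cylinderEvents (Set.Ico (-L : ℤ) L)) _ f :=
    (@measurable_const _ _ _ (cylinderEvents (Set.Ico (-L : ℤ) L)) (1 : ℝ)).indicator hA
  have hfint : ∫ w, f w ∂Q = Q.real A := by
    rw [hf, integral_indicator hA']; simp
  -- the modulus is kept positive also for `L = 0`
  set b : ℕ := 2 * L + 1 with hb
  have hmap : ∀ k : ℕ, Q.map (f ∘ shift^[k]) = Q.map f := fun k => by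
    rw [← Measure.map_map hfm (hT.iterate k).measurable, (hT.iterate k).map_eq]
  have hfkm : ∀ k : ℕ, Measurable (f ∘ shift^[k]) := fun k => hfm.comp (hT.iterate k).measurable
  have hres : ∀ r : ℕ, ∀ᵐ w ∂Q, Tendsto
      (fun m : ℕ => (∑ j ∈ Finset.range m, f (shift^[r + b * j] w)) / m) atTop
      (𝓝 (Q.real A)) := by
    intro r
    have hlaw : ∀ k : ℕ, IdentDistrib (f ∘ shift^[k]) f Q Q := fun k =>
      ⟨(hfkm k).aemeasurable, hfm.aemeasurable, hmap k⟩
    have hint : Integrable f Q := (integrable_const (1 : ℝ)).indicator hA'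
    have key := strong_law_ae_real (μ := Q) (fun j : ℕ => f ∘ shift^[r + b * j])
      ((hT.iterate _).integrable_comp_of_integrable hint) ?_
      (fun j => (hlaw _).trans (hlaw _).symm)
    · have hlim : Q[f ∘ shift^[r + b * 0]] = Q.real A := by
        rw [← hfint]; exact (hlaw _).integral_eq
      rw [hlim] at key
      exact key
    · intro i j hij
      have hm : ∀ k : ℕ, MeasurableSpace.comap (f ∘ shift^[k]) inferInstance ≤
          cylinderEvents (Set.Ico ((k : ℤ) - L) (k + L)) := fun k => by
        refine Measurable.comap_le ?_
        refine hfc.comp (measurable_shift_iterate_cylinderEvents fun i hi => ?_)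
        simp only [Set.mem_Ico] at hi ⊢
        omega
      change IndepFun (f ∘ shift^[r + b * i]) (f ∘ shift^[r + b * j]) Q
      rw [IndepFun_iff_Indep]
      refine indep_of_indep_of_le_right (indep_of_indep_of_le_left
        (indep_cylinderEvents μ ?_) (hm _)) (hm _)
      rw [Set.disjoint_left]
      intro x hx hy
      simp only [Set.mem_Ico] at hx hy
      push_cast at hx hy
      rcases lt_or_gt_of_ne hij with h | h
      · have : (b : ℤ) * i + b ≤ b * j := by
          have : (b * (i + 1) : ℕ) ≤ b * j := Nat.mul_le_mul_left b h
          rw [mul_add, mul_one] at this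
          exact_mod_cast this
        omega
      · have : (b : ℤ) * j + b ≤ b * i := by
          have : (b * (j + 1) : ℕ) ≤ b * i := Nat.mul_le_mul_left b h
          rw [mul_add, mul_one] at this
          exact_mod_cast this
        omega
  filter_upwards [ae_all_iff.2 hres] with w hw
  exact tendsto_sum_range_div_of_residues (g := fun k => f (shift^[k] w))
    (fun k => Set.indicator_nonneg (fun _ _ => zero_le_one) _) (by omega) fun r _ => hw r

end Shift

/-! ### The two-sided walk and the boundary event -/

section TwoSided

variable {E : Type*} [AddCommGroup E]

/-- The position at time `m` of the walk with step sequence `w`, started at the origin. -/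
def forwardWalk (w : ℤ → E) (m : ℕ) : E := ∑ i ∈ Finset.range m, w i

/-- The position at time `-m` of the two-sided walk with step sequence `w` which is at the origin
at time `0`. -/
def backwardWalk (w : ℤ → E) (m : ℕ) : E := -∑ i ∈ Finset.range m, w (-(i : ℤ) - 1)

/-- The two-sided walk avoids `H` at all times in `[-L, L]` and does not return to the origin
during `[1, L]`. -/
def boundaryEventUpTo (H : Set E) (L : ℕ) : Set (ℤ → E) :=
  {w | ∀ m ≤ L, forwardWalk w m ∉ H ∧ backwardWalk w m ∉ H ∧ (1 ≤ m → forwardWalk w m ≠ 0)}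

/-- The two-sided walk avoids `H` and does not return to the origin at positive times. -/
def boundaryEvent (H : Set E) : Set (ℤ → E) :=
  {w | ∀ m, forwardWalk w m ∉ H ∧ backwardWalk w m ∉ H ∧ (1 ≤ m → forwardWalk w m ≠ 0)}

lemma antitone_boundaryEventUpTo (H : Set E) : Antitone (boundaryEventUpTo H) :=
  fun _ _ hLL' _ hw m hm => hw m (hm.trans hLL')

lemma iInter_boundaryEventUpTo (H : Set E) : ⋂ L, boundaryEventUpTo H L = boundaryEvent H := by
  ext w
  simp only [Set.mem_iInter]
  exact ⟨fun h m => h m m le_rfl, fun h L m _ => h m⟩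

lemma measurableSet_boundaryEventUpTo [MeasurableSpace E] [Countable E]
    [MeasurableSingletonClass E] (H : Set E) (L : ℕ) :
    MeasurableSet[cylinderEvents (Set.Ico (-L : ℤ) L)] (boundaryEventUpTo H L) := by
  have hf : ∀ m ≤ L, @Measurable _ _ (cylinderEvents (Set.Ico (-L : ℤ) L)) _
      (fun w : ℤ → E => forwardWalk w m) := fun m hm =>
    Finset.measurable_sum _ fun i hi => measurable_cylinderEvent_apply (by
      simp only [Finset.mem_range] at hi
      simp only [Set.mem_Ico]
      omega)
  have hb : ∀ m ≤ L, @Measurable _ _ (cylinderEvents (Set.Ico (-L : ℤ) L)) _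
      (fun w : ℤ → E => backwardWalk w m) := fun m hm => by
    have h : @Measurable _ _ (cylinderEvents (Set.Ico (-L : ℤ) L)) _
        (fun w : ℤ → E => ∑ i ∈ Finset.range m, w (-(i : ℤ) - 1)) :=
      Finset.measurable_sum _ fun i hi => measurable_cylinderEvent_apply (by
        simp only [Finset.mem_range] at hi
        simp only [Set.mem_Ico]
        omega)
    exact h.neg
  have h : boundaryEventUpTo H L = ⋂ m ∈ Set.Iic L,
      ((fun w : ℤ → E => forwardWalk w m) ⁻¹' (Hᶜ ∩ {x | 1 ≤ m → x ≠ 0})) ∩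
        (fun w : ℤ → E => backwardWalk w m) ⁻¹' Hᶜ := by
    ext w
    simp only [boundaryEventUpTo, Set.mem_ofPred_eq, Set.mem_iInter, Set.mem_Iic, Set.mem_inter_iff,
      Set.mem_preimage, Set.mem_compl_iff]
    exact forall₂_congr fun m _ => by tauto
  rw [h]
  exact MeasurableSet.biInter (Set.to_countable _) fun m hm =>
    (hf m hm (Set.to_countable _).measurableSet).inter (hb m hm (Set.to_countable _).measurableSet)

lemma measurableSet_boundaryEvent [MeasurableSpace E] [Countable E] [MeasurableSingletonClass E]
    (H : Set E) : MeasurableSet (boundaryEvent H) := by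
  rw [← iInter_boundaryEventUpTo]
  exact MeasurableSet.iInter fun L =>
    cylinderEvents_le_pi _ (measurableSet_boundaryEventUpTo H L)

lemma forwardWalk_shift_iterate (w : ℤ → E) (k m : ℕ) :
    forwardWalk (shift^[k] w) m = forwardWalk w (k + m) - forwardWalk w k := by
  rw [eq_sub_iff_add_eq', shift_iterate]
  simp only [forwardWalk, Finset.sum_range_add]
  congr 1
  refine Finset.sum_congr rfl fun i _ => ?_
  congr 1
  push_cast
  ring

lemma backwardWalk_shift_iterate (w : ℤ → E) {k m : ℕ} (hm : m ≤ k) :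
    backwardWalk (shift^[k] w) m = forwardWalk w (k - m) - forwardWalk w k := by
  induction m with
  | zero => simp [backwardWalk]
  | succ m ih =>
    have h1 : backwardWalk (shift^[k] w) (m + 1) =
        backwardWalk (shift^[k] w) m - w ((k - (m + 1) : ℕ) : ℤ) := by
      simp only [backwardWalk, Finset.sum_range_succ, shift_iterate, neg_add, sub_eq_add_neg]
      congr 3
      push_cast [Nat.cast_sub hm]
      ring
    have h2 : forwardWalk w (k - m) =
        forwardWalk w (k - (m + 1)) + w ((k - (m + 1) : ℕ) : ℤ) := by
      rw [show k - m = (k - (m + 1)) + 1 by omega]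
      simp [forwardWalk, Finset.sum_range_succ]
    rw [h1, ih (by omega), h2]
    abel

end TwoSided

/-! ### Counting boundary points by their last visit -/

section Counting

variable {d : ℕ}

lemma birkhoffSum_indicator_one {X : Type*} (T : X → X) (A : Set X) (n : ℕ) (x : X)
    [DecidablePred fun k => T^[k] x ∈ A] :
    birkhoffSum T (A.indicator fun _ => (1 : ℝ)) n x =
      ((Finset.range n).filter fun k => T^[k] x ∈ A).card := by
  classical
  simp [birkhoffSum, Set.indicator_apply]

/-- Times whose recentred two-sided path lies in the boundary event are last visits to distinct
points of the boundary of the range. -/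
lemma birkhoffSum_boundaryEvent_le_ncard (H : Set (Fin d → ℤ)) (w : ℤ → (Fin d → ℤ)) (n : ℕ) :
    birkhoffSum shift ((boundaryEvent H).indicator fun _ => (1 : ℝ)) n w ≤
      (boundary H (pathRange (forwardWalk w) n)).ncard := by
  classical
  rw [birkhoffSum_indicator_one, Nat.cast_le, ← Set.ncard_coe_finset]
  have hfin : (boundary H (pathRange (forwardWalk w) n)).Finite :=
    ((Set.finite_Iic n).image _).subset fun y hy => hy.1
  refine Set.ncard_le_ncard_of_injOn (forwardWalk w) ?_ ?_ hfin
  · intro k hk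
    simp only [Finset.coe_filter, Finset.mem_range, Set.mem_ofPred_eq] at hk
    obtain ⟨hkn, hk⟩ := hk
    refine ⟨⟨k, hkn.le, rfl⟩, ?_⟩
    rintro h hh ⟨j, hj, hjk⟩
    rcases le_total k j with hkj | hkj
    · refine (hk (j - k)).1 ?_
      rw [forwardWalk_shift_iterate, Nat.add_sub_cancel' hkj, hjk, add_sub_cancel_left]
      exact hh
    · refine (hk (k - j)).2.1 ?_
      rw [backwardWalk_shift_iterate w (Nat.sub_le _ _), Nat.sub_sub_self hkj, hjk,
        add_sub_cancel_left]
      exact hh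
  · have hlt : ∀ i j : ℕ, shift^[i] w ∈ boundaryEvent H → i < j →
        forwardWalk w i ≠ forwardWalk w j := fun i j hi hij heq => by
      refine (hi (j - i)).2.2 (by omega) ?_
      rw [forwardWalk_shift_iterate, Nat.add_sub_cancel' hij.le, heq, sub_self]
    intro i hi j hj hij
    simp only [Finset.coe_filter, Finset.mem_range, Set.mem_ofPred_eq] at hi hj
    rcases lt_trichotomy i j with h | h | h
    · exact absurd hij (hlt i j hi.2 h)
    · exact h
    · exact absurd hij.symm (hlt j i hj.2 h)

/-- The last visit to a boundary point of the range up to time `n` occurs at a time whose recentred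
path lies in the truncated boundary event, unless it is within `L` of `0` or `n`. -/
lemma ncard_boundary_le_birkhoffSum (H : Set (Fin d → ℤ)) (w : ℤ → (Fin d → ℤ)) (L n : ℕ) :
    ((boundary H (pathRange (forwardWalk w) n)).ncard : ℝ) ≤
      birkhoffSum shift ((boundaryEventUpTo H L).indicator fun _ => (1 : ℝ)) n w + (2 * L + 1) := by
  classical
  rw [birkhoffSum_indicator_one]
  set F := (Finset.range n).filter fun k => shift^[k] w ∈ boundaryEventUpTo H L
  let G : Finset ℕ := F ∪ (Finset.range L ∪ Finset.Icc (n - L) n)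
  have hsub : boundary H (pathRange (forwardWalk w) n) ⊆ (G.image (forwardWalk w) : Set _) := by
    rintro y ⟨⟨k₀, hk₀, rfl⟩, hy⟩
    have hne : ((Finset.range (n + 1)).filter fun k =>
        forwardWalk w k = forwardWalk w k₀).Nonempty :=
      ⟨k₀, by simpa [Nat.lt_succ_iff] using hk₀⟩
    obtain ⟨k, hk, hmax⟩ := Finset.exists_max_image _ (fun k : ℕ => k) hne
    simp only [Finset.mem_filter, Finset.mem_range] at hk hmax
    rw [← hk.2] at hy ⊢
    refine Finset.mem_coe.2 (Finset.mem_image_of_mem _ ?_)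
    simp only [G, Finset.mem_union, Finset.mem_range, Finset.mem_Icc]
    by_cases hL : k < L
    · exact Or.inr (Or.inl hL)
    by_cases hn : n - L ≤ k
    · exact Or.inr (Or.inr ⟨hn, by omega⟩)
    have havoid : ∀ j ≤ n, forwardWalk w j - forwardWalk w k ∉ H := fun j hj hjH =>
      hy _ hjH ⟨j, hj, by abel⟩
    refine Or.inl (Finset.mem_filter.2 ⟨Finset.mem_range.2 (by omega), fun m hm => ⟨?_, ?_, ?_⟩⟩)
    · rw [forwardWalk_shift_iterate]
      exact havoid _ (by omega)
    · rw [backwardWalk_shift_iterate w (by omega)]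
      exact havoid _ (by omega)
    · intro hm1 h0
      rw [forwardWalk_shift_iterate, sub_eq_zero] at h0
      have := hmax (k + m) ⟨by omega, h0.trans hk.2⟩
      omega
  have hcard : (boundary H (pathRange (forwardWalk w) n)).ncard ≤ F.card + (2 * L + 1) := by
    calc _ ≤ (G.image (forwardWalk w) : Set _).ncard :=
          Set.ncard_le_ncard hsub (Finset.finite_toSet _)
      _ = (G.image (forwardWalk w)).card := Set.ncard_coe_finset _
      _ ≤ G.card := Finset.card_image_le
      _ ≤ F.card + ((Finset.range L).card + (Finset.Icc (n - L) n).card) :=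
          (Finset.card_union_le _ _).trans (Nat.add_le_add_left (Finset.card_union_le _ _) _)
      _ ≤ F.card + (2 * L + 1) := by
          simp only [Finset.card_range, Nat.card_Icc]
          omega
  exact_mod_cast hcard

/-- The law of large numbers for the boundary of the range of a walk on `ℤ^d` with i.i.d. steps of
arbitrary law. -/
lemma ae_tendsto_ncard_boundary_infinitePi (μ : Measure (Fin d → ℤ)) [IsProbabilityMeasure μ]
    (H : Set (Fin d → ℤ)) :
    ∀ᵐ w ∂(Measure.infinitePi fun _ : ℤ => μ), Tendsto
      (fun n : ℕ => ((boundary H (pathRange (forwardWalk w) n)).ncard : ℝ) / n) atTop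
      (𝓝 ((Measure.infinitePi fun _ : ℤ => μ).real (boundaryEvent H))) := by
  set Q : Measure (ℤ → (Fin d → ℤ)) := Measure.infinitePi fun _ : ℤ => μ with hQ
  have hloc : ∀ L, ∀ᵐ w ∂Q, Tendsto (fun n : ℕ => birkhoffSum shift
      ((boundaryEventUpTo H L).indicator fun _ => (1 : ℝ)) n w / n) atTop
      (𝓝 (Q.real (boundaryEventUpTo H L))) := fun L =>
    ae_tendsto_birkhoffSum_of_cylinderEvents μ (measurableSet_boundaryEventUpTo H L)
  have hmeas : ∀ L, MeasurableSet (boundaryEventUpTo H L) := fun L =>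
    cylinderEvents_le_pi _ (measurableSet_boundaryEventUpTo H L)
  have hglob := ae_tendsto_birkhoffSum_iInter (measurePreserving_shift μ) hmeas
    (antitone_boundaryEventUpTo H) hloc
  have hμ : Tendsto (fun L => Q.real (boundaryEventUpTo H L)) atTop
      (𝓝 (Q.real (boundaryEvent H))) := by
    rw [← iInter_boundaryEventUpTo]
    exact (ENNReal.tendsto_toReal (measure_ne_top _ _)).comp
      (tendsto_measure_iInter_atTop (fun L => (hmeas L).nullMeasurableSet)
        (antitone_boundaryEventUpTo H) ⟨0, measure_ne_top _ _⟩)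
  rw [iInter_boundaryEventUpTo] at hglob
  filter_upwards [ae_all_iff.2 hloc, hglob] with w hw hw'
  rw [tendsto_order]
  constructor
  · intro a ha
    filter_upwards [(tendsto_order.1 hw').1 a ha] with n hn
    exact hn.trans_le (div_le_div_of_nonneg_right (birkhoffSum_boundaryEvent_le_ncard H w n)
      (Nat.cast_nonneg n))
  · intro b hb
    obtain ⟨L, hL⟩ := ((tendsto_order.1 hμ).2 b hb).exists
    have h0 : Tendsto (fun n : ℕ => (2 * (L : ℝ) + 1) / n) atTop (𝓝 0) :=
      tendsto_const_div_atTop_nhds_zero_nat _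
    have hadd := (hw L).add h0
    rw [add_zero] at hadd
    filter_upwards [(tendsto_order.1 hadd).2 b hL] with n hn
    rw [← add_div] at hn
    exact (div_le_div_of_nonneg_right (ncard_boundary_le_birkhoffSum H w L n)
      (Nat.cast_nonneg n)).trans_lt hn

end Counting

/-! ### Realizing the two-sided walk by two independent walks -/

section Transfer

/-- The two-sided sequence with the entries of `p.1` at `0, 1, 2, …` and those of `p.2` at
`-1, -2, …`. -/
def glue {E : Type*} (p : (ℕ → E) × (ℕ → E)) : ℤ → E
  | Int.ofNat n => p.1 n
  | Int.negSucc n => p.2 n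

lemma measurable_glue {E : Type*} [MeasurableSpace E] : Measurable (glue (E := E)) := by
  refine measurable_pi_lambda _ fun i => ?_
  cases i with
  | ofNat n => exact (measurable_pi_apply n).comp measurable_fst
  | negSucc n => exact (measurable_pi_apply n).comp measurable_snd

lemma map_glue_prod_infinitePi {E : Type*} [MeasurableSpace E] (μ : Measure E)
    [IsProbabilityMeasure μ] :
    ((Measure.infinitePi fun _ : ℕ => μ).prod (Measure.infinitePi fun _ : ℕ => μ)).map glue =
      Measure.infinitePi fun _ : ℤ => μ := by
  classical
  refine Measure.eq_infinitePi _ fun s t ht => ?_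
  have hinj₁ : Function.Injective Int.ofNat := fun _ _ h => Int.ofNat.inj h
  have hinj₂ : Function.Injective Int.negSucc := fun _ _ h => Int.negSucc.inj h
  set s₁ : Finset ℕ := s.preimage Int.ofNat hinj₁.injOn
  set s₂ : Finset ℕ := s.preimage Int.negSucc hinj₂.injOn
  have hpre : glue (E := E) ⁻¹' (s : Set ℤ).pi t =
      (s₁ : Set ℕ).pi (fun n => t (Int.ofNat n)) ×ˢ
        (s₂ : Set ℕ).pi fun n => t (Int.negSucc n) := by
    ext ⟨u, v⟩
    simp only [Set.mem_preimage, Set.mem_pi, Set.mem_prod, Finset.mem_coe, s₁, s₂,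
      Finset.mem_preimage]
    constructor
    · exact fun h => ⟨fun n hn => h _ hn, fun n hn => h _ hn⟩
    · rintro ⟨h₁, h₂⟩ (n | n) hn
      · exact h₁ n hn
      · exact h₂ n hn
  rw [Measure.map_apply measurable_glue
    (MeasurableSet.pi s.countable_toSet fun i _ => ht i), hpre, Measure.prod_prod,
    Measure.infinitePi_pi _ fun i _ => ht _, Measure.infinitePi_pi _ fun i _ => ht _,
    Finset.prod_preimage' Int.ofNat s hinj₁.injOn fun i => μ (t i),
    Finset.prod_preimage' Int.negSucc s hinj₂.injOn fun i => μ (t i),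
    ← Finset.prod_filter_mul_prod_filter_not s fun i => i ∈ Set.range Int.ofNat]
  congr 2
  ext i
  cases i <;> simp

variable {d : ℕ}

/-- The `2 d` steps `± e_i` are pairwise distinct. -/
lemma injective_unitSteps :
    Function.Injective (Sum.elim (fun i : Fin d => (Pi.single i 1 : Fin d → ℤ))
      fun i : Fin d => -Pi.single i 1) := by
  rintro (i | i) (j | j) h
  all_goals
    have hi := congrFun h i
    simp only [Sum.elim_inl, Sum.elim_inr, Pi.neg_apply, Pi.single_eq_same, Pi.single_apply] at hi
    split_ifs at hi with hij
    all_goals first | (subst hij; rfl) | omega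

/-- A probability measure giving mass `1 / (2 d)` to each of the `2 d` unit steps is determined. -/
lemma measure_eq_of_unitSteps (hd : d ≠ 0) {μ ν : Measure (Fin d → ℤ)} [IsProbabilityMeasure μ]
    [IsProbabilityMeasure ν]
    (hμ₁ : ∀ i, μ {Pi.single i 1} = (2 * (d : ENNReal))⁻¹)
    (hμ₂ : ∀ i, μ {-Pi.single i 1} = (2 * (d : ENNReal))⁻¹)
    (hν₁ : ∀ i, ν {Pi.single i 1} = (2 * (d : ENNReal))⁻¹)
    (hν₂ : ∀ i, ν {-Pi.single i 1} = (2 * (d : ENNReal))⁻¹) : μ = ν := by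
  set B : Finset (Fin d → ℤ) := Finset.univ.map ⟨_, injective_unitSteps (d := d)⟩ with hB
  have hfull : ∀ ρ : Measure (Fin d → ℤ), IsProbabilityMeasure ρ →
      (∀ i, ρ {Pi.single i 1} = (2 * (d : ENNReal))⁻¹) →
      (∀ i, ρ {-Pi.single i 1} = (2 * (d : ENNReal))⁻¹) → ρ (B : Set (Fin d → ℤ))ᶜ = 0 := by
    intro ρ _ h₁ h₂
    rw [prob_compl_eq_zero_iff B.measurableSet, ← sum_measure_singleton, hB, Finset.sum_map]
    simp only [Function.Embedding.coeFn_mk, Fintype.sum_sum_type, Sum.elim_inl, Sum.elim_inr, h₁,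
      h₂, Finset.sum_const, Finset.card_univ, Fintype.card_fin, nsmul_eq_mul]
    rw [← two_mul, ← mul_assoc]
    exact ENNReal.mul_inv_cancel (by simpa using hd)
      (ENNReal.mul_ne_top (by simp) (ENNReal.natCast_ne_top d))
  refine Measure.ext_iff_singleton.2 fun x => ?_
  by_cases hx : x ∈ B
  · obtain ⟨i | i, -, rfl⟩ := Finset.mem_map.1 hx
    · exact (hμ₁ i).trans (hν₁ i).symm
    · exact (hμ₂ i).trans (hν₂ i).symm
  · have hsub : ({x} : Set (Fin d → ℤ)) ⊆ (B : Set (Fin d → ℤ))ᶜ := by simpa using hx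
    rw [measure_mono_null hsub (hfull μ inferInstance hμ₁ hμ₂),
      measure_mono_null hsub (hfull ν inferInstance hν₁ hν₂)]

variable {Ω : Type*} {S : ℕ → Ω → (Fin d → ℤ)}

/-- The sequence of steps of the walk `S`. -/
def steps (S : ℕ → Ω → (Fin d → ℤ)) (ω : Ω) (n : ℕ) : Fin d → ℤ := S (n + 1) ω - S n ω

/-- The two-sided step sequence built from two points of `Ω`: the steps of the first walk are the
future, those of the second one, in reversed order, the past. -/
def twoSidedSteps (S : ℕ → Ω → (Fin d → ℤ)) (p : Ω × Ω) : ℤ → (Fin d → ℤ) :=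
  glue (steps S p.1, steps S p.2)

lemma forwardWalk_twoSidedSteps {p : Ω × Ω} (h : S 0 p.1 = 0) (m : ℕ) :
    forwardWalk (twoSidedSteps S p) m = S m p.1 := by
  have : forwardWalk (twoSidedSteps S p) m = ∑ i ∈ Finset.range m, (S (i + 1) p.1 - S i p.1) := rfl
  rw [this, Finset.sum_range_sub fun i => S i p.1, h, sub_zero]

lemma backwardWalk_twoSidedSteps {p : Ω × Ω} (h : S 0 p.2 = 0) (m : ℕ) :
    backwardWalk (twoSidedSteps S p) m = -S m p.2 := by
  have : backwardWalk (twoSidedSteps S p) m =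
      -∑ i ∈ Finset.range m, (S (i + 1) p.2 - S i p.2) := by
    unfold backwardWalk
    congr 1
    refine Finset.sum_congr rfl fun i _ => ?_
    rw [show -(i : ℤ) - 1 = Int.negSucc i by omega]
    rfl
  rw [this, Finset.sum_range_sub fun i => S i p.2, h, sub_zero]

variable [MeasurableSpace Ω] {P : Measure Ω}

lemma IsSimpleRandomWalk.measurable_steps_apply (hS : IsSimpleRandomWalk P S) (n : ℕ) :
    Measurable fun ω => steps S ω n :=
  (hS.measurable (n + 1)).sub (hS.measurable n)

lemma IsSimpleRandomWalk.measurable_steps (hS : IsSimpleRandomWalk P S) : Measurable (steps S) :=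
  measurable_pi_lambda _ hS.measurable_steps_apply

lemma IsSimpleRandomWalk.map_steps [IsProbabilityMeasure P] (hS : IsSimpleRandomWalk P S)
    (hd : d ≠ 0) :
    P.map (steps S) =
      Measure.infinitePi fun _ : ℕ => P.map fun ω => steps S ω 0 := by
  have h := iIndepFun.map_fun_eq_infinitePi_map hS.measurable_steps_apply hS.indep
  have hprob : ∀ n, IsProbabilityMeasure (P.map fun ω => steps S ω n) := fun n =>
    Measure.isProbabilityMeasure_map (hS.measurable_steps_apply n).aemeasurable
  have hlaw : ∀ n, (P.map fun ω => steps S ω n) = P.map fun ω => steps S ω 0 := by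
    have hpos : ∀ n i, (P.map fun ω => steps S ω n) {Pi.single i 1} = (2 * (d : ENNReal))⁻¹ :=
      fun n i => by
        rw [Measure.map_apply (hS.measurable_steps_apply n) (measurableSet_singleton _)]
        exact hS.step_pos n i
    have hneg : ∀ n i, (P.map fun ω => steps S ω n) {-Pi.single i 1} = (2 * (d : ENNReal))⁻¹ :=
      fun n i => by
        rw [Measure.map_apply (hS.measurable_steps_apply n) (measurableSet_singleton _)]
        exact hS.step_neg n i
    exact fun n => measure_eq_of_unitSteps hd (hpos n) (hneg n) (hpos 0) (hneg 0)
  simp_rw [hlaw] at h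
  exact h

lemma IsSimpleRandomWalk.measurePreserving_twoSidedSteps [IsProbabilityMeasure P]
    (hS : IsSimpleRandomWalk P S) (hd : d ≠ 0) :
    MeasurePreserving (twoSidedSteps S) (P.prod P)
      (Measure.infinitePi fun _ : ℤ => P.map fun ω => steps S ω 0) := by
  have hprob : IsProbabilityMeasure (P.map fun ω => steps S ω 0) :=
    Measure.isProbabilityMeasure_map (hS.measurable_steps_apply 0).aemeasurable
  have h1 : MeasurePreserving (steps S) P
      (Measure.infinitePi fun _ : ℕ => P.map fun ω => steps S ω 0) :=
    ⟨hS.measurable_steps, hS.map_steps hd⟩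
  have h2 : MeasurePreserving (glue (E := Fin d → ℤ)) _ _ :=
    ⟨measurable_glue, map_glue_prod_infinitePi (P.map fun ω => steps S ω 0)⟩
  exact h2.comp (h1.prod h1)

lemma IsSimpleRandomWalk.ae_prod_start (hS : IsSimpleRandomWalk P S) :
    ∀ᵐ p ∂P.prod P, S 0 p.1 = 0 ∧ S 0 p.2 = 0 :=
  (Measure.quasiMeasurePreserving_fst.ae hS.start).and
    (Measure.quasiMeasurePreserving_snd.ae hS.start)

lemma IsSimpleRandomWalk.limitConst_eq [IsProbabilityMeasure P] (hS : IsSimpleRandomWalk P S)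
    (hd : d ≠ 0) (H : Set (Fin d → ℤ)) :
    limitConst P S H =
      (Measure.infinitePi fun _ : ℤ => P.map fun ω => steps S ω 0).real (boundaryEvent H) := by
  rw [← (hS.measurePreserving_twoSidedSteps hd).measureReal_preimage
    (measurableSet_boundaryEvent H).nullMeasurableSet]
  refine measureReal_congr ?_
  filter_upwards [hS.ae_prod_start] with p hp
  refine propext ?_
  change ((Set.range (fun m => -S m p.2) ∪ Set.range (fun m => S m p.1)) ∩ H = ∅ ∧
      0 ∉ (fun m => S m p.1) '' Set.Ici 1) ↔ ∀ m, forwardWalk (twoSidedSteps S p) m ∉ H ∧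
      backwardWalk (twoSidedSteps S p) m ∉ H ∧
      (1 ≤ m → forwardWalk (twoSidedSteps S p) m ≠ 0)
  simp only [forwardWalk_twoSidedSteps hp.1, backwardWalk_twoSidedSteps hp.2,
    ← Set.disjoint_iff_inter_eq_empty, Set.disjoint_left, Set.mem_union, or_imp, forall_and,
    Set.forall_mem_range, Set.mem_image, Set.mem_Ici, not_exists, not_and]
  tauto

end Transfer

end RangeBoundary

theorem theorem2p3 {Ω : Type*} [MeasurableSpace Ω] (P : Measure Ω) [IsProbabilityMeasure P]
    (d M : ℕ) (hd : 3 ≤ d) (S : ℕ → Ω → (Fin d → ℤ))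
    (hS : RangeBoundary.IsSimpleRandomWalk P S)
    (H : Set (Fin d → ℤ)) (hH : H ∈ RangeBoundary.admissible P S M) :
    ∀ᵐ ω ∂P, Tendsto
      (fun n : ℕ =>
        ((RangeBoundary.boundary H (RangeBoundary.pathRange (fun m => S m ω) n)).ncard : ℝ) / n)
      atTop (𝓝 (RangeBoundary.limitConst P S H)) := by
  have hd0 : d ≠ 0 := by omega
  have hprob : IsProbabilityMeasure (P.map fun ω => RangeBoundary.steps S ω 0) :=
    Measure.isProbabilityMeasure_map (hS.measurable_steps_apply 0).aemeasurable
  have key := (hS.measurePreserving_twoSidedSteps hd0).quasiMeasurePreserving.ae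
    (RangeBoundary.ae_tendsto_ncard_boundary_infinitePi
      (P.map fun ω => RangeBoundary.steps S ω 0) H)
  rw [← hS.limitConst_eq hd0] at key
  have hne : (ae P).NeBot := ae_neBot.2 (IsProbabilityMeasure.ne_zero P)
  filter_upwards [Measure.ae_ae_of_ae_prod key, hS.start] with ω hω h0
  -- the statement does not depend on the past, so one point of the second factor is enough
  obtain ⟨ω', hω'⟩ := hω.exists
  have hpath : RangeBoundary.forwardWalk (RangeBoundary.twoSidedSteps S (ω, ω')) =
      fun m => S m ω := funext (RangeBoundary.forwardWalk_twoSidedSteps h0)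
  rwa [hpath] at hω'
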